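/- Let $s,t\ge 0$ be integers with $s+t\ge 1$, let $\mathcal V=\mathbb R^{s,t}$ be $\mathbb R^{s+t}$ with the quadratic form $q(x,y)=x_1^2+\dots+x_s^2-y_1^2-\dots-y_t^2$, and let $\mathcal G=\mathcal T(\mathcal V)/\langle v\otimes v-q(v)\rangle$ be its geometric (Clifford) algebra, so that $v^2=q(v)$ for $v\in\mathcal V\subseteq\mathcal G$. Let $x\mapsto x^\star$ be the grade involution (the algebra automorphism with $v^\star=-v$ for $v \in \mathcal V$), $x\mapsto x^\dagger$ the reversion (the algebra antiautomorphism with $v^\dagger=v$ for $v \in \mathcal V$), $\mathcal G^+$ the even subalgebra, and $\mathcal G^\times$ the group of invertible elements of $\mathcal G$. Let $\Gamma$ be the group of all finite products $v_1v_2\cdots v_k$ of vectors $v_i\in\mathcal V$ with $v_i^2\neq 0$, and put $$\mathrm{Pin}(s,t)=\{x\in\Gamma: xx^\dagger=\pm1\},\quad \mathrm{Spin}(s,t)=\mathrm{Pin}(s,t)\cap\mathcal G^+,\quad \mathrm{Spin}^+(s,t)=\{x\in\mathrm{Spin}(s,t):xx^\dagger=1\}.$$ Let $\mathrm O(s,t)$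 be the group of invertible linear maps $f:\mathcal V\to\mathcal V$ with $q\circ f=q$, let $\mathrm{SO}(s,t)=\{f\in\mathrm O(s,t):\det f=1\}$, and let $\mathrm{SO}^+(s,t)$ be the connected component of the identity in $\mathrm{SO}(s,t)$. For $x\in\mathcal G^\times$ let $\widetilde{\mathrm{Ad}}_x(y)=x^\star y x^{-1}$ for $y \in \mathcal G$ (the twisted adjoint action). Then $x\mapsto\widetilde{\mathrm{Ad}}_x|_{\mathcal V}$ defines group homomorphisms $$\mathrm{Pin}(s,t)\to\mathrm O(s,t),\qquad \mathrm{Spin}(s,t)\to\mathrm{SO}(s,t),\qquad \mathrm{Spin}^+(s,t)\to\mathrm{SO}^+(s,t),$$ and each of them is surjective with kernel $\{1,-1\}$. -/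

import Mathlib

namespace GeomAlg

open CliffordAlgebra

noncomputable section

/-! ### Groups in the geometric algebra of a real quadratic space -/

section Groups

variable {V : Type*} [AddCommGroup V] [Module ℝ V] (q : QuadraticForm ℝ V)

/-- The twisted adjoint action `x ↦ (y ↦ x⋆ y x⁻¹)` of the invertible elements of the geometric
algebra on the geometric algebra; `x⋆` is the grade involution `involute x`. -/
def twistedAdjoint : (CliffordAlgebra q)ˣ →* Module.End ℝ (CliffordAlgebra q) where
  toFun x := LinearMap.mulLeft ℝ (involute (x : CliffordAlgebra q)) ∘ₗ
    LinearMap.mulRight ℝ ((x⁻¹ : (CliffordAlgebra q)ˣ) : CliffordAlgebra q)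
  map_one' := by
    apply LinearMap.ext
    intro y
    simp
  map_mul' x z := by
    apply LinearMap.ext
    intro y
    simp [mul_assoc]

theorem twistedAdjoint_apply (x : (CliffordAlgebra q)ˣ) (y : CliffordAlgebra q) :
    twistedAdjoint q x y =
      involute (x : CliffordAlgebra q) * y * ((x⁻¹ : (CliffordAlgebra q)ˣ) : CliffordAlgebra q) := by
  simp [twistedAdjoint, mul_assoc]

theorem prod_mul_prod_inverse (l : List V) (hl : ∀ v ∈ l, q v ≠ 0) :
    (l.map (ι q)).prod * ((l.reverse.map fun v => (q v)⁻¹ • v).map (ι q)).prod = 1 := by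
  induction l with
  | nil => simp
  | cons v l ih =>
    have hv : q v ≠ 0 := hl v (by simp)
    have h := ih fun w hw => hl w (by simp [hw])
    have h2 : ι q v * ι q ((q v)⁻¹ • v) = 1 := by
      rw [map_smul, mul_smul_comm, ι_sq_scalar]
      simp [Algebra.smul_def, ← map_mul, hv]
    simp only [List.map_cons, List.prod_cons, List.reverse_cons, List.map_append, List.map_nil,
      List.prod_append, List.prod_nil, mul_one]
    calc _ = ι q v * ((l.map (ι q)).prod *
          ((l.reverse.map fun v => (q v)⁻¹ • v).map (ι q)).prod) * ι q ((q v)⁻¹ • v) := by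
          simp only [mul_assoc]
      _ = 1 := by rw [h, mul_one, h2]

/-- The versor group `Γ`: all finite products `v₁ v₂ ⋯ vₖ` of invertible vectors, that is, of
vectors with `v² = q v ≠ 0`. -/
def versorGroup : Subgroup (CliffordAlgebra q)ˣ where
  carrier := {x | ∃ l : List V, (∀ v ∈ l, q v ≠ 0) ∧
    (x : CliffordAlgebra q) = (l.map (ι q)).prod}
  one_mem' := ⟨[], by simp, by simp⟩
  mul_mem' := by
    rintro x y ⟨l, hl, hx⟩ ⟨m, hm, hy⟩
    refine ⟨l ++ m, ?_, by simp [hx, hy]⟩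
    intro v hv
    rcases List.mem_append.1 hv with h | h
    exacts [hl v h, hm v h]
  inv_mem' := by
    rintro x ⟨l, hl, hx⟩
    refine ⟨l.reverse.map fun v => (q v)⁻¹ • v, ?_, ?_⟩
    · intro v hv
      obtain ⟨w, hw, rfl⟩ := List.mem_map.1 hv
      have := hl w (List.mem_reverse.1 hw)
      simp [QuadraticMap.map_smul, this]
    · exact Units.inv_eq_of_mul_eq_one_right (by rw [hx]; exact prod_mul_prod_inverse q l hl)

theorem reverse_inv_mul_reverse (x : (CliffordAlgebra q)ˣ) :
    reverse ((x⁻¹ : (CliffordAlgebra q)ˣ) : CliffordAlgebra q) *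
      reverse (x : CliffordAlgebra q) = 1 := by
  rw [← reverse.map_mul, Units.mul_inv, reverse.map_one]

/-- `Pin = {x ∈ Γ : x x† = ±1}`, where `x†` is the reversion `reverse x`. -/
def Pin : Subgroup (CliffordAlgebra q)ˣ where
  carrier := {x | x ∈ versorGroup q ∧
    ((x : CliffordAlgebra q) * reverse (x : CliffordAlgebra q) = 1 ∨
      (x : CliffordAlgebra q) * reverse (x : CliffordAlgebra q) = -1)}
  one_mem' := ⟨one_mem _, by simp⟩
  mul_mem' := by
    rintro x y ⟨hx, hx'⟩ ⟨hy, hy'⟩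
    refine ⟨mul_mem hx hy, ?_⟩
    have h : ((x * y : (CliffordAlgebra q)ˣ) : CliffordAlgebra q) *
        reverse ((x * y : (CliffordAlgebra q)ˣ) : CliffordAlgebra q) =
        x * (y * reverse (y : CliffordAlgebra q)) * reverse (x : CliffordAlgebra q) := by
      simp [reverse.map_mul, mul_assoc]
    rw [h]
    rcases hx' with hx' | hx' <;> rcases hy' with hy' | hy' <;> simp [hx', hy']
  inv_mem' := by
    rintro x ⟨hx, hx'⟩
    refine ⟨inv_mem hx, ?_⟩
    have h := reverse_inv_mul_reverse q x
    have e : ∀ c : CliffordAlgebra q, (x : CliffordAlgebra q) * reverse (x : CliffordAlgebra q) = c →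
        reverse (x : CliffordAlgebra q) =
          ((x⁻¹ : (CliffordAlgebra q)ˣ) : CliffordAlgebra q) * c := by
      rintro c rfl
      simp
    rcases hx' with hx' | hx'
    · left
      rw [e _ hx', mul_one] at h
      have h3 := Units.mul_inv_eq_one.1 h
      rw [h3]
      simp
    · right
      rw [e _ hx', mul_neg_one, mul_neg, ← neg_mul] at h
      have h3 := Units.mul_inv_eq_one.1 h
      rw [neg_eq_iff_eq_neg] at h3
      rw [h3]
      simp

/-- `Spin = Pin ∩ 𝒢⁺`, where `𝒢⁺` is the even subalgebra. -/
def Spin : Subgroup (CliffordAlgebra q)ˣ where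
  carrier := {x | x ∈ Pin q ∧ (x : CliffordAlgebra q) ∈ even q}
  one_mem' := ⟨one_mem _, by simp⟩
  mul_mem' := by
    rintro x y ⟨hx, hx'⟩ ⟨hy, hy'⟩
    exact ⟨mul_mem hx hy, by simpa using mul_mem hx' hy'⟩
  inv_mem' := by
    rintro x ⟨hx, hx'⟩
    refine ⟨inv_mem hx, ?_⟩
    have hr : reverse (x : CliffordAlgebra q) ∈ even q := by
      have := (reverse_mem_evenOdd_iff (Q := q) (x := (x : CliffordAlgebra q)) (n := 0)).2 hx'
      exact this
    rcases hx.2 with h | h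
    · rw [Units.inv_eq_of_mul_eq_one_right h]
      exact hr
    · have h' : (x : CliffordAlgebra q) * -reverse (x : CliffordAlgebra q) = 1 := by
        rw [mul_neg, h, neg_neg]
      rw [Units.inv_eq_of_mul_eq_one_right h']
      exact neg_mem hr

/-- The rotor group `Spin⁺ = {x ∈ Spin : x x† = 1}`. -/
def SpinPlus : Subgroup (CliffordAlgebra q)ˣ where
  carrier := {x | x ∈ Spin q ∧
    (x : CliffordAlgebra q) * reverse (x : CliffordAlgebra q) = 1}
  one_mem' := ⟨one_mem _, by simp⟩
  mul_mem' := by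
    rintro x y ⟨hx, hx'⟩ ⟨hy, hy'⟩
    refine ⟨mul_mem hx hy, ?_⟩
    have h : ((x * y : (CliffordAlgebra q)ˣ) : CliffordAlgebra q) *
        reverse ((x * y : (CliffordAlgebra q)ˣ) : CliffordAlgebra q) =
        x * (y * reverse (y : CliffordAlgebra q)) * reverse (x : CliffordAlgebra q) := by
      simp [reverse.map_mul, mul_assoc]
    rw [h, hy', mul_one, hx']
  inv_mem' := by
    rintro x ⟨hx, hx'⟩
    refine ⟨inv_mem hx, ?_⟩
    have h := reverse_inv_mul_reverse q x
    rw [← Units.inv_eq_of_mul_eq_one_right hx'] at h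
    have h3 := Units.mul_inv_eq_one.1 h
    rw [h3]
    simp

end Groups

/-! ### The space `ℝ^{s,t}` and its orthogonal groups -/

/-- The quadratic form `x₁² + ⋯ + xₛ² - y₁² - ⋯ - yₜ²` on `ℝ^{s+t}`. -/
def form (s t : ℕ) : QuadraticForm ℝ (Fin s ⊕ Fin t → ℝ) :=
  QuadraticMap.weightedSumSquares ℝ (Sum.elim (fun _ => (1 : ℝ)) (fun _ => (-1 : ℝ)))

theorem form_apply (s t : ℕ) (v : Fin s ⊕ Fin t → ℝ) :
    form s t v = ∑ i, v (Sum.inl i) ^ 2 - ∑ j, v (Sum.inr j) ^ 2 := by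
  simp [form, QuadraticMap.weightedSumSquares_apply, sub_eq_add_neg, pow_two]

open scoped Matrix

/-- `O(s,t)`: the invertible linear maps of `ℝ^{s,t}`, given by their matrices in the standard
basis, that preserve the quadratic form. -/
def O (s t : ℕ) : Subgroup (GL (Fin s ⊕ Fin t) ℝ) where
  carrier := {f | ∀ v, form s t (f.val *ᵥ v) = form s t v}
  one_mem' := by simp
  mul_mem' := by
    intro f g hf hg v
    rw [Units.val_mul, ← Matrix.mulVec_mulVec, hf, hg]
  inv_mem' := by
    intro f hf v
    rw [← hf, Matrix.mulVec_mulVec, Units.mul_inv, Matrix.one_mulVec]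

/-- `SO(s,t) = {f ∈ O(s,t) : det f = 1}`. -/
def SO (s t : ℕ) : Subgroup (GL (Fin s ⊕ Fin t) ℝ) where
  carrier := {f | f ∈ O s t ∧ f.val.det = 1}
  one_mem' := ⟨one_mem _, by simp⟩
  mul_mem' := by
    rintro f g ⟨hf, hf'⟩ ⟨hg, hg'⟩
    exact ⟨mul_mem hf hg, by simp [hf', hg']⟩
  inv_mem' := by
    rintro f ⟨hf, hf'⟩
    refine ⟨inv_mem hf, ?_⟩
    have h : f.val.det * (f⁻¹).val.det = 1 := by
      rw [← Matrix.det_mul, Units.mul_inv, Matrix.det_one]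
    rwa [hf', one_mul] at h

/-- `SO⁺(s,t)`: the connected component of the identity in `SO(s,t)`. -/
def SOPlus (s t : ℕ) : Subgroup (GL (Fin s ⊕ Fin t) ℝ) :=
  (Subgroup.connectedComponentOfOne (SO s t)).map (SO s t).subtype

end

end GeomAlg

namespace GeomAlg

open CliffordAlgebra

/-! ### Elements killed by all contractions -/

section Contraction

variable {K V κ : Type*} [Field K] [CharZero K] [AddCommGroup V] [Module K V]

theorem sum_ι_mul_contractLeft_of_mem_exteriorPower [Fintype κ] (b : Module.Basis κ K V) (k : ℕ)
    {x : ExteriorAlgebra K V} (hx : x ∈ ⋀[K]^k V) :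
    ∑ i, ExteriorAlgebra.ι K (b i) * contractLeft (b.coord i) x = (k : K) • x := by
  induction hx using Submodule.pow_induction_on_left' with
  | algebraMap r => simp
  | add x y i hx hy ihx ihy => simp only [map_add, mul_add, Finset.sum_add_distrib, ihx, ihy,
      smul_add]
  | mem_mul m hm i x hx ih =>
    obtain ⟨v, rfl⟩ := hm
    have hv : ∑ i, b.coord i v • ExteriorAlgebra.ι K (b i) = ExteriorAlgebra.ι K v := by
      simp only [Module.Basis.coord_apply, ← map_smul, ← map_sum, b.sum_repr]
    have hanti (u : V) (y : ExteriorAlgebra K V) :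
        ExteriorAlgebra.ι K u * (ExteriorAlgebra.ι K v * y) =
          -(ExteriorAlgebra.ι K v * (ExteriorAlgebra.ι K u * y)) := by
      rw [← mul_assoc, ← mul_assoc, ← neg_mul, eq_neg_of_add_eq_zero_left
        (ExteriorAlgebra.ι_add_mul_swap (R := K) u v)]
    have hterm (i : κ) : ExteriorAlgebra.ι K (b i) *
        contractLeft (b.coord i) (ExteriorAlgebra.ι K v * x) =
        (b.coord i v • ExteriorAlgebra.ι K (b i)) * x + ExteriorAlgebra.ι K v *
          (ExteriorAlgebra.ι K (b i) * contractLeft (b.coord i) x) := by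
      have h := contractLeft_ι_mul (Q := (0 : QuadraticForm K V)) (b.coord i) v x
      rw [show contractLeft (b.coord i) (ExteriorAlgebra.ι K v * x) = _ from h, mul_sub]
      rw [show ι (0 : QuadraticForm K V) v = ExteriorAlgebra.ι K v from rfl, hanti, sub_neg_eq_add,
        smul_mul_assoc, mul_smul_comm]
    rw [Finset.sum_congr rfl fun i _ => hterm i, Finset.sum_add_distrib, ← Finset.sum_mul, hv,
      ← Finset.mul_sum, ih, mul_smul_comm, Nat.succ_eq_add_one, Nat.cast_add, add_smul,
      Nat.cast_one, one_smul, add_comm]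

theorem exteriorAlgebra_mem_range_algebraMap [Finite κ] (b : Module.Basis κ K V)
    {x : ExteriorAlgebra K V} (hx : ∀ d : Module.Dual K V, contractLeft d x = 0) :
    ∃ c : K, algebraMap K _ c = x := by
  classical
  have := Fintype.ofFinite κ
  let E : ExteriorAlgebra K V →ₗ[K] ExteriorAlgebra K V :=
    ∑ i, LinearMap.mulLeft K (ExteriorAlgebra.ι K (b i)) ∘ₗ contractLeft (b.coord i)
  have hE (y : ExteriorAlgebra K V) :
      E y = ∑ i, ExteriorAlgebra.ι K (b i) * contractLeft (b.coord i) y := by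
    simp [E]
  let A : ℕ → Submodule K (ExteriorAlgebra K V) := fun k => ⋀[K]^k V
  have hproj (k : ℕ) (y : ExteriorAlgebra K V) :
      (DirectSum.decompose A (E y) k : ExteriorAlgebra K V) =
        (k : K) • (DirectSum.decompose A y k : ExteriorAlgebra K V) := by
    induction y using DirectSum.Decomposition.inductionOn A with
    | zero => simp
    | add y z hy hz => simp [hy, hz]
    | @homogeneous i y =>
      rw [hE, sum_ι_mul_contractLeft_of_mem_exteriorPower b i y.2]
      by_cases h : i = k
      · subst h
        rw [DirectSum.decompose_of_mem_same A (Submodule.smul_mem _ _ y.2),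
          DirectSum.decompose_of_mem_same A y.2]
      · rw [DirectSum.decompose_of_mem_ne A (Submodule.smul_mem _ _ y.2) h,
          DirectSum.decompose_of_mem_ne A y.2 h, smul_zero]
  have hEx : E x = 0 := by simp [hE, hx]
  have hk (k : ℕ) (h : k ≠ 0) : (DirectSum.decompose A x k : ExteriorAlgebra K V) = 0 := by
    have := hproj k x
    rw [hEx] at this
    simpa [h] using this.symm
  have hx0 : (DirectSum.decompose A x 0 : ExteriorAlgebra K V) = x := by
    conv_rhs => rw [← DirectSum.sum_support_decompose A x]
    symm
    refine Finset.sum_eq_single 0 (fun k _ h => hk k h) fun h => ?_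
    simpa using h
  have hmem : x ∈ ⋀[K]^0 V := hx0 ▸ (DirectSum.decompose A x 0).2
  simpa [Submodule.mem_one] using hmem

/-- In the Clifford algebra of a finite-dimensional space over a field of characteristic zero, only
scalars are killed by all contractions. -/
theorem mem_range_algebraMap_of_contractLeft_eq_zero (q : QuadraticForm K V) [Finite κ]
    (b : Module.Basis κ K V) {x : CliffordAlgebra q}
    (hx : ∀ d : Module.Dual K V, contractLeft d x = 0) :
    ∃ c : K, algebraMap K _ c = x := by
  have : Invertible (2 : K) := invertibleOfNonzero two_ne_zero
  let h := changeForm.associated_neg_proof (Q := q)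
  obtain ⟨c, hc⟩ := exteriorAlgebra_mem_range_algebraMap b (x := changeForm h x) fun d => by
    rw [← changeForm_contractLeft, hx, map_zero]
  refine ⟨c, (changeFormEquiv h).injective ?_⟩
  rw [changeFormEquiv_apply, changeFormEquiv_apply, ← hc, changeForm_algebraMap]

theorem ι_injective (q : QuadraticForm K V) : Function.Injective (ι q) := by
  have : Invertible (2 : K) := invertibleOfNonzero two_ne_zero
  let h := changeForm.associated_neg_proof (Q := q)
  intro v w hvw
  have := congrArg (changeForm h) hvw
  rw [changeForm_ι, changeForm_ι] at this
  exact ExteriorAlgebra.ι_leftInverse.injective this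

omit [CharZero K] in
theorem ι_mul_sub_involute_mul_ι (q : QuadraticForm K V) (v : V) (x : CliffordAlgebra q) :
    ι q v * x - involute x * ι q v = contractLeft (QuadraticMap.polarBilin q v) x := by
  induction x using CliffordAlgebra.left_induction with
  | algebraMap r => simp [Algebra.commutes]
  | add x y hx hy => rw [map_add, map_add, ← hx, ← hy, mul_add, add_mul]; abel
  | ι_mul x w hx =>
    rw [contractLeft_ι_mul, ← hx, map_mul, involute_ι, mul_sub, ← mul_assoc,
      QuadraticMap.polarBilin_apply_apply, Algebra.smul_def, ← ι_mul_ι_add_swap, add_mul]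
    noncomm_ring

end Contraction

end GeomAlg

namespace GeomAlg

open CliffordAlgebra

/-! ### Products of vectors -/

section Products

variable {V : Type*} [AddCommGroup V] [Module ℝ V] (q : QuadraticForm ℝ V)

theorem prod_map_ι_mul_reverse (l : List V) :
    (l.map (ι q)).prod * reverse (l.map (ι q)).prod =
      algebraMap ℝ (CliffordAlgebra q) (l.map q).prod := by
  induction l with
  | nil => simp
  | cons v l ih =>
    rw [List.map_cons, List.prod_cons, reverse.map_mul, reverse_ι, List.map_cons, List.prod_cons]
    calc _ = ι q v * ((l.map (ι q)).prod * reverse (l.map (ι q)).prod) * ι q v := by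
          simp only [mul_assoc]
      _ = _ := by rw [ih, ← Algebra.commutes, mul_assoc, ι_sq_scalar, ← map_mul, mul_comm]

theorem prod_map_ι_mem_evenOdd (l : List V) :
    (l.map (ι q)).prod ∈ evenOdd q (l.length : ZMod 2) := by
  induction l with
  | nil => simpa using SetLike.GradedOne.one_mem (A := evenOdd q)
  | cons v l ih =>
    rw [List.map_cons, List.prod_cons, List.length_cons, Nat.cast_add, Nat.cast_one, add_comm]
    exact SetLike.mul_mem_graded (ι_mem_evenOdd_one q v) ih

theorem prod_map_ι_mem_even {l : List V} (hl : Even l.length) :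
    (l.map (ι q)).prod ∈ even q := by
  have h := prod_map_ι_mem_evenOdd q l
  rw [(ZMod.natCast_eq_zero_iff_even).2 hl] at h
  exact h

theorem even_length_of_prod_map_ι_mem_even {l : List V} (h0 : (l.map (ι q)).prod ≠ 0)
    (h : (l.map (ι q)).prod ∈ even q) : Even l.length := by
  by_contra hl
  have h1 := prod_map_ι_mem_evenOdd q l
  rw [(ZMod.natCast_eq_one_iff_odd).2 (Nat.not_even_iff_odd.1 hl)] at h1
  exact h0 ((Submodule.disjoint_def.1 (evenOdd_isCompl (Q := q)).disjoint) _ h h1)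

theorem isUnit_prod_map_ι {l : List V} (hl : ∀ v ∈ l, q v ≠ 0) :
    IsUnit (l.map (ι q)).prod := by
  refine List.prod_induction IsUnit (fun _ _ => IsUnit.mul) isUnit_one ?_
  intro x hx
  obtain ⟨v, hv, rfl⟩ := List.mem_map.1 hx
  exact isUnit_ι_of_isUnit q (hl v hv).isUnit

theorem twistedAdjoint_ι_eq_iff (x : (CliffordAlgebra q)ˣ) (v w : V) :
    ι q w = twistedAdjoint q x (ι q v) ↔
      involute (x : CliffordAlgebra q) * ι q v = ι q w * (x : CliffordAlgebra q) := by
  rw [twistedAdjoint_apply, Units.eq_mul_inv_iff_mul_eq, eq_comm]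

theorem twistedAdjoint_neg_one (y : CliffordAlgebra q) : twistedAdjoint q (-1) y = y := by
  simp [twistedAdjoint_apply]

/-- For a nondegenerate form on a finite-dimensional space, the twisted adjoint action has only
scalars in its kernel. -/
theorem exists_algebraMap_eq_of_twistedAdjoint_eq {κ : Type*} [Finite κ] (b : Module.Basis κ ℝ V)
    (hq : Function.Surjective (QuadraticMap.polarBilin q)) {x : (CliffordAlgebra q)ˣ}
    (hx : ∀ v, ι q v = twistedAdjoint q x (ι q v)) :
    ∃ c : ℝ, algebraMap ℝ _ c = (x : CliffordAlgebra q) := by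
  refine mem_range_algebraMap_of_contractLeft_eq_zero q b fun d => ?_
  obtain ⟨v, rfl⟩ := hq d
  rw [← ι_mul_sub_involute_mul_ι, (twistedAdjoint_ι_eq_iff q x v v).1 (hx v), sub_self]

theorem eq_one_or_eq_neg_one_of_mem_Pin {κ : Type*} [Finite κ] (b : Module.Basis κ ℝ V)
    (hq : Function.Surjective (QuadraticMap.polarBilin q)) {x : (CliffordAlgebra q)ˣ}
    (hP : x ∈ Pin q) (hx : ∀ v, ι q v = twistedAdjoint q x (ι q v)) : x = 1 ∨ x = -1 := by
  have : Invertible (2 : ℝ) := invertibleOfNonzero two_ne_zero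
  obtain ⟨c, hc⟩ := exists_algebraMap_eq_of_twistedAdjoint_eq q b hq hx
  have hinj := FaithfulSMul.algebraMap_injective ℝ (CliffordAlgebra q)
  have h := hP.2
  rw [← hc, reverse.commutes, ← map_mul, ← map_one (algebraMap ℝ (CliffordAlgebra q)),
    ← map_neg, hinj.eq_iff, hinj.eq_iff] at h
  have h1 : c * c = 1 := h.resolve_right (by nlinarith [mul_self_nonneg c])
  refine (mul_self_eq_one_iff.1 h1).imp ?_ ?_ <;> rintro rfl <;> ext <;> simp [← hc]

theorem neg_one_mem_SpinPlus {v : V} (hv : q v ≠ 0) : -1 ∈ SpinPlus q := by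
  have h1 : (-1 : (CliffordAlgebra q)ˣ) ∈ versorGroup q := by
    refine ⟨[v, -(q v)⁻¹ • v], ?_, ?_⟩
    · simp [QuadraticMap.map_smul, hv]
    · simp [ι_sq_scalar, Algebra.algebraMap_eq_smul_one, smul_smul, hv]
  have h2 : ((-1 : (CliffordAlgebra q)ˣ) : CliffordAlgebra q) *
      reverse ((-1 : (CliffordAlgebra q)ˣ) : CliffordAlgebra q) = 1 := by simp
  exact ⟨⟨⟨h1, Or.inl h2⟩, by simp⟩, h2⟩

end Products

/-! ### Signs of products of real numbers -/

section Signs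

theorem neg_one_pow_mul_prod_pos {l : List ℝ} (hl : ∀ a ∈ l, a < 0) :
    0 < (-1) ^ l.length * l.prod := by
  induction l with
  | nil => simp
  | cons a l ih =>
    have ha : a < 0 := hl a (by simp)
    have h := ih fun b hb => hl b (by simp [hb])
    rw [List.length_cons, List.prod_cons, pow_succ]
    nlinarith

theorem exists_mem_mul_pos {a : ℝ} {l : List ℝ} (hl : ∀ b ∈ l, b ≠ 0) (hlen : Odd l.length)
    (h : 0 < a * l.prod) : ∃ b ∈ l, 0 < a * b := by
  by_contra! hneg
  have ha : a ≠ 0 := by rintro rfl; simp at h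
  have h1 := neg_one_pow_mul_prod_pos (l := l.map (a * ·)) (by
    intro c hc
    obtain ⟨b, hb, rfl⟩ := List.mem_map.1 hc
    exact lt_of_le_of_ne (hneg b hb) (mul_ne_zero ha (hl b hb)))
  rw [List.length_map, hlen.neg_one_pow, List.prod_map_mul] at h1
  obtain ⟨k, hk⟩ := hlen
  have h2 : (l.map fun _ => a).prod = a * (a ^ k) ^ 2 := by
    rw [List.map_const', List.prod_replicate, hk]; ring
  rw [h2, List.map_id'] at h1
  nlinarith [sq_nonneg (a ^ k), mul_nonneg h.le (sq_nonneg (a ^ k))]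

theorem exists_pos_and_exists_neg {l : List ℝ} (hl : ∀ b ∈ l, b ≠ 0) (hlen : Even l.length)
    (h : l.prod < 0) : (∃ b ∈ l, 0 < b) ∧ ∃ b ∈ l, b < 0 := by
  constructor
  · by_contra! hneg
    have h1 := neg_one_pow_mul_prod_pos fun b hb => lt_of_le_of_ne (hneg b hb) (hl b hb)
    rw [hlen.neg_one_pow] at h1
    linarith
  · by_contra! hpos
    exact absurd h (List.prod_pos fun b hb => lt_of_le_of_ne (hpos b hb) (hl b hb).symm).le.not_gt

theorem prod_eq_one_or_neg_one {l : List ℝ} (hl : ∀ b ∈ l, b = 1 ∨ b = -1) :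
    l.prod = 1 ∨ l.prod = -1 := by
  induction l with
  | nil => simp
  | cons a l ih =>
    rcases hl a (by simp) with rfl | rfl <;>
    rcases ih fun b hb => hl b (by simp [hb]) with h | h <;> simp [h]

end Signs

end GeomAlg

namespace GeomAlg

open CliffordAlgebra QuadraticMap
open scoped Matrix

/-! ### Reflections of `ℝ^{s,t}` -/

section Reflections

variable {s t : ℕ}

theorem polar_form (v w : Fin s ⊕ Fin t → ℝ) :
    polar (form s t) v w =
      (fun i => 2 * (Sum.elim (fun _ => (1 : ℝ)) (fun _ => (-1 : ℝ)) i * v i)) ⬝ᵥ w := by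
  simp only [polar, form, weightedSumSquares_apply, dotProduct, ← Finset.sum_sub_distrib]
  refine Finset.sum_congr rfl fun i _ => ?_
  simp only [Pi.add_apply, smul_eq_mul]
  ring

theorem form_add (v w : Fin s ⊕ Fin t → ℝ) :
    form s t (v + w) = form s t v + form s t w + polar (form s t) v w := by
  simp [polar]

theorem polar_form_self (v : Fin s ⊕ Fin t → ℝ) :
    polar (form s t) v v = 2 * form s t v := by
  rw [polar_self, two_smul, two_mul]

theorem form_sub (v w : Fin s ⊕ Fin t → ℝ) :
    form s t (v - w) = form s t v + form s t w - polar (form s t) v w := by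
  rw [sub_eq_add_neg, form_add, polar_neg_right, QuadraticMap.map_neg, sub_eq_add_neg]

theorem form_smul (c : ℝ) (v : Fin s ⊕ Fin t → ℝ) : form s t (c • v) = c ^ 2 * form s t v := by
  rw [QuadraticMap.map_smul, smul_eq_mul, pow_two]

theorem polar_form_single_single {i j : Fin s ⊕ Fin t} (h : i ≠ j) :
    polar (form s t) (Pi.single i 1) (Pi.single j 1) = 0 := by
  rw [polar_form]
  simp [h]

theorem form_single (i : Fin s ⊕ Fin t) :
    form s t (Pi.single i 1) = Sum.elim (fun _ => (1 : ℝ)) (fun _ => (-1 : ℝ)) i := by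
  have h : polar (form s t) (Pi.single i 1) (Pi.single i 1) =
      2 * Sum.elim (fun _ => (1 : ℝ)) (fun _ => (-1 : ℝ)) i := by
    rw [polar_form]; simp
  rw [polar_form_self] at h
  linarith

theorem form_single_ne_zero (i : Fin s ⊕ Fin t) : form s t (Pi.single i 1) ≠ 0 := by
  rw [form_single]
  cases i <;> simp

theorem polarBilin_form_surjective :
    Function.Surjective (polarBilin (form s t)) := by
  intro d
  refine ⟨fun i => Sum.elim (fun _ => (1 : ℝ)) (fun _ => (-1 : ℝ)) i * d (Pi.single i 1) / 2, ?_⟩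
  refine LinearMap.pi_ext' fun i => LinearMap.ext_ring ?_
  rw [LinearMap.comp_apply, LinearMap.comp_apply, LinearMap.single_apply,
    polarBilin_apply_apply, polar_form, dotProduct_single]
  cases i <;> simp <;> ring

/-- The matrix of the reflection along `v`; it is the identity if `v` is isotropic. -/
noncomputable def reflectionMatrix (v : Fin s ⊕ Fin t → ℝ) :
    Matrix (Fin s ⊕ Fin t) (Fin s ⊕ Fin t) ℝ :=
  1 - Matrix.vecMulVec ((form s t v)⁻¹ • v)
    (fun i => 2 * (Sum.elim (fun _ => (1 : ℝ)) (fun _ => (-1 : ℝ)) i * v i))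

theorem reflectionMatrix_mulVec (v w : Fin s ⊕ Fin t → ℝ) :
    reflectionMatrix v *ᵥ w = w - (polar (form s t) v w * (form s t v)⁻¹) • v := by
  rw [reflectionMatrix, Matrix.sub_mulVec, Matrix.one_mulVec, Matrix.vecMulVec_mulVec, polar_form,
    op_smul_eq_smul, smul_smul]

theorem polar_reflectionMatrix_mulVec (v w : Fin s ⊕ Fin t → ℝ) (hv : form s t v ≠ 0) :
    polar (form s t) v (reflectionMatrix v *ᵥ w) = -polar (form s t) v w := by
  rw [reflectionMatrix_mulVec, polar_sub_right, polar_smul_right, polar_form_self, smul_eq_mul]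
  field_simp
  ring

theorem reflectionMatrix_of_form_eq_zero {v : Fin s ⊕ Fin t → ℝ} (hv : form s t v = 0) :
    reflectionMatrix v = 1 := by
  simp [reflectionMatrix, hv]

theorem reflectionMatrix_mul_self (v : Fin s ⊕ Fin t → ℝ) :
    reflectionMatrix v * reflectionMatrix v = 1 := by
  by_cases hv : form s t v = 0
  · rw [reflectionMatrix_of_form_eq_zero hv, one_mul]
  · refine Matrix.ext_of_mulVec_single fun i => ?_
    rw [← Matrix.mulVec_mulVec, reflectionMatrix_mulVec v (reflectionMatrix v *ᵥ _),
      polar_reflectionMatrix_mulVec _ _ hv, reflectionMatrix_mulVec, Matrix.one_mulVec, neg_mul,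
      neg_smul]
    abel

/-- The reflection along `v`; it is the identity if `v` is isotropic. -/
noncomputable def reflection (v : Fin s ⊕ Fin t → ℝ) : GL (Fin s ⊕ Fin t) ℝ :=
  ⟨reflectionMatrix v, reflectionMatrix v, reflectionMatrix_mul_self v,
    reflectionMatrix_mul_self v⟩

theorem reflection_mulVec (v w : Fin s ⊕ Fin t → ℝ) :
    (reflection v).val *ᵥ w = w - (polar (form s t) v w * (form s t v)⁻¹) • v :=
  reflectionMatrix_mulVec v w

theorem reflection_mul_self (v : Fin s ⊕ Fin t → ℝ) : reflection v * reflection v = 1 :=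
  Units.ext (reflectionMatrix_mul_self v)

theorem eq_of_mulVec_eq {f g : GL (Fin s ⊕ Fin t) ℝ}
    (h : ∀ v, f.val *ᵥ v = g.val *ᵥ v) : f = g :=
  Units.ext (Matrix.ext_of_mulVec_single fun _ => h _)

theorem reflection_mem_O (v : Fin s ⊕ Fin t → ℝ) : reflection v ∈ O s t := by
  intro w
  by_cases hv : form s t v = 0
  · rw [show (reflection v).val = 1 from reflectionMatrix_of_form_eq_zero hv, Matrix.one_mulVec]
  · rw [reflection_mulVec, form_sub, form_smul, polar_smul_right, polar_comm _ w v, smul_eq_mul]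
    field_simp
    ring

theorem det_reflection {v : Fin s ⊕ Fin t → ℝ} (hv : form s t v ≠ 0) :
    (reflection v).val.det = -1 := by
  have h := Matrix.det_one_add_replicateCol_mul_replicateRow (ι := Unit) (-((form s t v)⁻¹ • v))
    (fun i => 2 * (Sum.elim (fun _ => (1 : ℝ)) (fun _ => (-1 : ℝ)) i * v i))
  rw [← Matrix.vecMulVec_eq, Matrix.neg_vecMulVec, ← sub_eq_add_neg] at h
  refine h.trans ?_
  rw [dotProduct_neg, dotProduct_smul, ← polar_form, polar_form_self, smul_eq_mul]
  field_simp
  ring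

theorem reflection_smul {c : ℝ} (hc : c ≠ 0) (v : Fin s ⊕ Fin t → ℝ) :
    reflection (c • v) = reflection v := by
  refine eq_of_mulVec_eq fun w => ?_
  rw [reflection_mulVec, reflection_mulVec, form_smul, polar_smul_left, smul_smul, smul_eq_mul]
  congr 2
  field_simp

theorem polar_mulVec_mulVec {g : GL (Fin s ⊕ Fin t) ℝ} (hg : g ∈ O s t)
    (v w : Fin s ⊕ Fin t → ℝ) :
    polar (form s t) (g.val *ᵥ v) (g.val *ᵥ w) = polar (form s t) v w := by
  rw [polar, ← Matrix.mulVec_add, hg, hg, hg, polar]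

theorem mul_reflection {g : GL (Fin s ⊕ Fin t) ℝ} (hg : g ∈ O s t) (v : Fin s ⊕ Fin t → ℝ) :
    g * reflection v = reflection (g.val *ᵥ v) * g := by
  refine eq_of_mulVec_eq fun w => ?_
  rw [Units.val_mul, Units.val_mul, ← Matrix.mulVec_mulVec, ← Matrix.mulVec_mulVec,
    reflection_mulVec, reflection_mulVec, polar_mulVec_mulVec hg, hg, Matrix.mulVec_sub,
    Matrix.mulVec_smul]

theorem reflection_sub_mulVec {v w : Fin s ⊕ Fin t → ℝ} (h : form s t v = form s t w)
    (hvw : form s t (v - w) ≠ 0) : (reflection (v - w)).val *ᵥ v = w := by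
  have : polar (form s t) (v - w) v = form s t (v - w) := by
    rw [polar_sub_left, polar_form_self, form_sub, h, polar_comm _ w v]; ring
  rw [reflection_mulVec, this, mul_inv_cancel₀ hvw, one_smul, sub_sub_cancel]

theorem exists_reflection_eq {v : Fin s ⊕ Fin t → ℝ} (hv : form s t v ≠ 0) :
    ∃ w, (form s t w = 1 ∨ form s t w = -1) ∧ reflection w = reflection v := by
  have h0 : 0 < |form s t v| := abs_pos.2 hv
  have hc : (√|form s t v|)⁻¹ ≠ 0 := inv_ne_zero (Real.sqrt_pos.2 h0).ne'
  refine ⟨(√|form s t v|)⁻¹ • v, ?_, reflection_smul hc v⟩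
  rw [form_smul, inv_pow, Real.sq_sqrt h0.le]
  rcases lt_or_gt_of_ne hv with h | h
  · right; rw [abs_of_neg h]; field_simp
  · left; rw [abs_of_pos h]; field_simp

/-- Every element of `O(s,t)` is a product of reflections. -/
theorem exists_list_prod_reflection {g : GL (Fin s ⊕ Fin t) ℝ} (hg : g ∈ O s t) :
    ∃ l : List (Fin s ⊕ Fin t → ℝ), (∀ v ∈ l, form s t v = 1 ∨ form s t v = -1) ∧
      (l.map reflection).prod = g := by
  suffices H : ∀ (S : Finset (Fin s ⊕ Fin t)) (g : GL (Fin s ⊕ Fin t) ℝ), g ∈ O s t →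
      (∀ i ∉ S, g.val *ᵥ Pi.single i 1 = Pi.single i 1) →
      ∃ l : List (Fin s ⊕ Fin t → ℝ), (∀ v ∈ l, form s t v = 1 ∨ form s t v = -1) ∧
        (l.map reflection).prod = g from H Finset.univ g hg (by simp)
  intro S
  induction S using Finset.induction_on with
  | empty =>
    intro g _ h
    refine ⟨[], by simp, ?_⟩
    refine Units.ext (Matrix.ext_of_mulVec_single fun i => ?_)
    rw [h i (by simp), List.map_nil, List.prod_nil, Units.val_one, Matrix.one_mulVec]
  | insert a S ha ih =>
    intro g hg h
    have step : ∀ v, form s t v ≠ 0 → (∀ i ∉ insert a S, polar (form s t) v (Pi.single i 1) = 0) →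
        ∀ g : GL (Fin s ⊕ Fin t) ℝ, g ∈ O s t →
        (∀ i ∉ insert a S, g.val *ᵥ Pi.single i 1 = Pi.single i 1) →
        ∀ i ∉ insert a S, (reflection v * g).val *ᵥ Pi.single i 1 = Pi.single i 1 := by
      intro v hv hi g hg h i his
      rw [Units.val_mul, ← Matrix.mulVec_mulVec, h i his, reflection_mulVec, hi i his, zero_mul,
        zero_smul, sub_zero]
    have key : ∀ g : GL (Fin s ⊕ Fin t) ℝ, g ∈ O s t →
        (∀ i ∉ insert a S, g.val *ᵥ Pi.single i 1 = Pi.single i 1) →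
        form s t (g.val *ᵥ Pi.single a 1 - Pi.single a 1) ≠ 0 →
        ∃ l : List (Fin s ⊕ Fin t → ℝ), (∀ v ∈ l, form s t v = 1 ∨ form s t v = -1) ∧
          (l.map reflection).prod = g := by
      intro g hg h hne
      set v := g.val *ᵥ Pi.single a 1 - Pi.single a 1 with hv
      have hperp : ∀ i ∉ insert a S, polar (form s t) v (Pi.single i 1) = 0 := by
        intro i hi
        have hia : a ≠ i := fun e => hi (e ▸ Finset.mem_insert_self a S)
        rw [hv, polar_sub_left, polar_form_single_single hia, sub_zero]
        conv_lhs => rw [← h i hi]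
        rw [polar_mulVec_mulVec hg, polar_form_single_single hia]
      obtain ⟨l, hl, hlg⟩ := ih (reflection v * g) (mul_mem (reflection_mem_O v) hg) (by
        intro i hi
        by_cases hia : i = a
        · subst hia
          rw [Units.val_mul, ← Matrix.mulVec_mulVec]
          exact reflection_sub_mulVec (hg _) hne
        · exact step v hne hperp g hg h i (by simp [hia, hi]))
      obtain ⟨w, hw, hwv⟩ := exists_reflection_eq hne
      refine ⟨w :: l, ?_, ?_⟩
      · rintro u (_ | ⟨_, hu⟩)
        exacts [hw, hl u hu]
      · rw [List.map_cons, List.prod_cons, hlg, hwv, ← mul_assoc, reflection_mul_self, one_mul]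
    by_cases hne : form s t (g.val *ᵥ Pi.single a 1 - Pi.single a 1) = 0
    · set u : Fin s ⊕ Fin t → ℝ := Pi.single a 1 with hu
      have hu0 : form s t u ≠ 0 := form_single_ne_zero a
      have hru : (reflection u).val *ᵥ u = -u := by
        rw [reflection_mulVec, polar_form_self, mul_inv_cancel_right₀ hu0, two_smul]
        abel
      have hperp : ∀ i ∉ insert a S, polar (form s t) u (Pi.single i 1) = 0 := fun i hi =>
        polar_form_single_single fun e => hi (e ▸ Finset.mem_insert_self a S)
      have hne' : form s t ((reflection u * g).val *ᵥ u - u) ≠ 0 := by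
        have e : (reflection u * g).val *ᵥ u - u =
            (reflection u).val *ᵥ (g.val *ᵥ u + u) := by
          rw [Matrix.mulVec_add, hru, Units.val_mul, Matrix.mulVec_mulVec, sub_eq_add_neg]
        rw [e, reflection_mem_O u, form_add]
        rw [form_sub] at hne
        rw [hg] at hne ⊢
        intro h0
        exact hu0 (by linarith)
      obtain ⟨l, hl, hlg⟩ := key (reflection u * g) (mul_mem (reflection_mem_O u) hg)
        (step u hu0 hperp g hg h) hne'
      obtain ⟨w, hw, hwu⟩ := exists_reflection_eq hu0
      refine ⟨w :: l, ?_, ?_⟩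
      · rintro u (_ | ⟨_, hu⟩)
        exacts [hw, hl u hu]
      · rw [List.map_cons, List.prod_cons, hlg, hwu, ← mul_assoc, reflection_mul_self, one_mul]
    · exact key g hg h hne

theorem prod_reflection_mem_O (l : List (Fin s ⊕ Fin t → ℝ)) :
    (l.map reflection).prod ∈ O s t := by
  refine Subgroup.list_prod_mem _ fun x hx => ?_
  obtain ⟨v, _, rfl⟩ := List.mem_map.1 hx
  exact reflection_mem_O v

theorem det_prod_reflection {l : List (Fin s ⊕ Fin t → ℝ)} (hl : ∀ v ∈ l, form s t v ≠ 0) :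
    (l.map reflection).prod.val.det = (-1) ^ l.length := by
  induction l with
  | nil => simp
  | cons v l ih =>
    rw [List.map_cons, List.prod_cons, Units.val_mul, Matrix.det_mul,
      det_reflection (hl v (by simp)),
      ih fun w hw => hl w (by simp [hw]), List.length_cons, pow_succ, mul_comm]

theorem prod_reflection_mem_SO_iff {l : List (Fin s ⊕ Fin t → ℝ)}
    (hl : ∀ v ∈ l, form s t v ≠ 0) : (l.map reflection).prod ∈ SO s t ↔ Even l.length := by
  rw [← neg_one_pow_eq_one_iff_even (R := ℝ) (by norm_num), ← det_prod_reflection hl]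
  exact ⟨fun h => h.2, fun h => ⟨prod_reflection_mem_O l, h⟩⟩

theorem involute_prod_mul_ι {l : List (Fin s ⊕ Fin t → ℝ)} (hl : ∀ v ∈ l, form s t v ≠ 0)
    (w : Fin s ⊕ Fin t → ℝ) :
    involute (l.map (ι (form s t))).prod * ι (form s t) w =
      ι (form s t) ((l.map reflection).prod.val *ᵥ w) * (l.map (ι (form s t))).prod := by
  induction l with
  | nil => simp
  | cons v l ih =>
    have hv : form s t v ≠ 0 := hl v (by simp)
    have key (u : Fin s ⊕ Fin t → ℝ) : -ι (form s t) v * ι (form s t) u =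
        ι (form s t) ((reflection v).val *ᵥ u) * ι (form s t) v := by
      rw [reflection_mulVec, map_sub, map_smul, sub_mul, smul_mul_assoc, ι_sq_scalar,
        Algebra.algebraMap_eq_smul_one, smul_smul, inv_mul_cancel_right₀ hv,
        ← Algebra.algebraMap_eq_smul_one, ← ι_mul_ι_add_swap]
      noncomm_ring
    simp only [List.map_cons, List.prod_cons, map_mul, involute_ι, Units.val_mul]
    rw [mul_assoc, ih fun u hu => hl u (by simp [hu]), ← mul_assoc, key, ← Matrix.mulVec_mulVec,
      mul_assoc]

end Reflections

end GeomAlg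

namespace GeomAlg

open CliffordAlgebra QuadraticMap
open scoped Matrix

/-! ### The identity component of `SO(s,t)` -/

section IdentityComponent

variable {s t : ℕ}

theorem continuous_form : Continuous (form s t) := by
  simp only [funext (form_apply s t)]
  fun_prop

theorem continuous_reflection {X : Type*} [TopologicalSpace X] {f : X → Fin s ⊕ Fin t → ℝ}
    (hf : Continuous f) (h : ∀ x, form s t (f x) ≠ 0) :
    Continuous fun x => reflection (f x) := by
  have hM : Continuous fun x => reflectionMatrix (f x) := by
    have h1 : Continuous fun x => (form s t (f x))⁻¹ := (continuous_form.comp hf).inv₀ h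
    unfold reflectionMatrix
    refine continuous_const.sub (Continuous.matrix_vecMulVec (h1.smul hf) ?_)
    fun_prop
  exact Units.continuous_iff.2 ⟨hM, hM⟩

theorem mem_SOPlus_iff {g : GL (Fin s ⊕ Fin t) ℝ} :
    g ∈ SOPlus s t ↔ ∃ h : g ∈ SO s t, (⟨g, h⟩ : SO s t) ∈ connectedComponent (1 : SO s t) := by
  constructor
  · rintro ⟨x, hx, rfl⟩
    exact ⟨x.2, hx⟩
  · rintro ⟨h, hx⟩
    exact ⟨⟨g, h⟩, hx, rfl⟩

theorem reflection_mul_reflection_mem_SO {v w : Fin s ⊕ Fin t → ℝ} (hv : form s t v ≠ 0)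
    (hw : form s t w ≠ 0) : reflection v * reflection w ∈ SO s t := by
  have h := (prod_reflection_mem_SO_iff (l := [v, w]) (by simp [hv, hw])).2 (by simp)
  simpa using h

/-- Two reflections along vectors on which the form has the same sign differ by an element of the
identity component. -/
theorem reflection_mul_reflection_mem_SOPlus {v w : Fin s ⊕ Fin t → ℝ}
    (h : 0 < form s t v * form s t w) : reflection v * reflection w ∈ SOPlus s t := by
  have hv : form s t v ≠ 0 := left_ne_zero_of_mul h.ne'
  have hw : form s t w ≠ 0 := right_ne_zero_of_mul h.ne'
  wlog hp : 0 ≤ form s t v * polar (form s t) v w generalizing w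
  · have hneg : reflection (-w) = reflection w := by
      rw [← neg_one_smul ℝ w, reflection_smul (by norm_num)]
    rw [← hneg]
    refine this (by rwa [QuadraticMap.map_neg]) (by rwa [QuadraticMap.map_neg]) ?_
    rw [polar_neg_right, mul_neg]
    linarith
  have hne (x : unitInterval) : form s t ((1 - (x : ℝ)) • v + (x : ℝ) • w) ≠ 0 := by
    refine right_ne_zero_of_mul (a := form s t v) (ne_of_gt ?_)
    rw [form_add, form_smul, form_smul, polar_smul_left, polar_smul_right, smul_eq_mul, smul_eq_mul]
    have hx0 := x.2.1
    have hx1 : 0 ≤ 1 - (x : ℝ) := sub_nonneg.2 x.2.2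
    have h1 : 0 < form s t v * form s t v := mul_self_pos.2 hv
    have h2 : 0 ≤ ((1 - (x : ℝ)) * x) * (form s t v * polar (form s t) v w) := by positivity
    have h3 : 0 < (1 - (x : ℝ)) ^ 2 * (form s t v * form s t v) +
        (x : ℝ) ^ 2 * (form s t v * form s t w) := by
      rcases hx0.eq_or_lt with h0 | h0
      · rw [← h0]; simpa using hv
      · have : 0 < (x : ℝ) ^ 2 * (form s t v * form s t w) := by positivity
        have : 0 ≤ (1 - (x : ℝ)) ^ 2 * (form s t v * form s t v) := by positivity
        linarith
    linarith
  let γ : unitInterval → SO s t := fun x =>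
    ⟨reflection ((1 - (x : ℝ)) • v + (x : ℝ) • w) * reflection w,
      reflection_mul_reflection_mem_SO (hne x) hw⟩
  have hγ : Continuous γ := by
    refine Continuous.subtype_mk ?_ _
    exact (continuous_reflection (by fun_prop) hne).mul continuous_const
  refine mem_SOPlus_iff.2 ⟨reflection_mul_reflection_mem_SO hv hw, ?_⟩
  refine (isPreconnected_range hγ).subset_connectedComponent ⟨1, ?_⟩ ⟨0, ?_⟩
  · exact Subtype.ext (by simp [γ, reflection_mul_self])
  · exact Subtype.ext (by simp [γ])

theorem form_ne_zero_of_prod_ne_zero {l : List (Fin s ⊕ Fin t → ℝ)}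
    (h : (l.map (form s t)).prod ≠ 0)
    {v : Fin s ⊕ Fin t → ℝ} (hv : v ∈ l) : form s t v ≠ 0 := fun h0 =>
  h (List.prod_eq_zero (List.mem_map.2 ⟨v, hv, h0⟩))

theorem prod_reflection_mem_SOPlus {l : List (Fin s ⊕ Fin t → ℝ)} (hlen : Even l.length)
    (h : 0 < (l.map (form s t)).prod) : (l.map reflection).prod ∈ SOPlus s t := by
  induction hn : l.length using Nat.strong_induction_on generalizing l with
  | _ n ih =>
    cases l with
    | nil => simp
    | cons v l =>
      have hne : ∀ w ∈ v :: l, form s t w ≠ 0 := fun w => form_ne_zero_of_prod_ne_zero h.ne'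
      rw [List.length_cons, Nat.even_add_one, Nat.not_even_iff_odd] at hlen
      rw [List.map_cons, List.prod_cons] at h
      obtain ⟨_, hb, hvb⟩ := exists_mem_mul_pos (a := form s t v) (l := l.map (form s t))
        (by
          intro b hb
          obtain ⟨w, hw, rfl⟩ := List.mem_map.1 hb
          exact hne w (by simp [hw]))
        (by rwa [List.length_map]) h
      obtain ⟨w, hw, rfl⟩ := List.mem_map.1 hb
      obtain ⟨a, b, rfl⟩ := List.append_of_mem hw
      set g := (a.map reflection).prod with hg
      have hgO : g ∈ O s t := prod_reflection_mem_O a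
      have hprod : ((v :: (a ++ w :: b)).map reflection).prod =
          (reflection v * reflection (g.val *ᵥ w)) * ((a ++ b).map reflection).prod := by
        simp only [List.map_cons, List.map_append, List.prod_cons, List.prod_append, ← hg]
        rw [← mul_assoc g, mul_reflection hgO]
        simp only [mul_assoc]
      rw [hprod]
      refine mul_mem (reflection_mul_reflection_mem_SOPlus (by rwa [hgO])) 
        (ih (a ++ b).length ?_ ?_ ?_ rfl)
      · rw [← hn]; simp
      · simp only [List.length_append, List.length_cons] at hlen ⊢
        rwa [← add_assoc, Nat.odd_add_one, Nat.not_odd_iff_even] at hlen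
      · have e : form s t v * ((a ++ w :: b).map (form s t)).prod =
            (form s t v * form s t w) * ((a ++ b).map (form s t)).prod := by
          simp only [List.map_cons, List.map_append, List.prod_cons, List.prod_append]
          ring
        rw [e] at h
        exact (mul_pos_iff_of_pos_left hvb).1 h

theorem det_toBlocks₁₁_ne_zero {g : GL (Fin s ⊕ Fin t) ℝ} (hg : g ∈ O s t) :
    g.val.toBlocks₁₁.det ≠ 0 := by
  intro h
  obtain ⟨x, hx0, hx⟩ := Matrix.exists_mulVec_eq_zero_iff.2 h
  have h1 := hg (Sum.elim x 0)
  have h2 (i : Fin s) : (g.val *ᵥ Sum.elim x 0) (Sum.inl i) = 0 := by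
    rw [← Matrix.fromBlocks_toBlocks g.val, Matrix.fromBlocks_mulVec]
    have h0 : (Sum.elim x (0 : Fin t → ℝ)) ∘ Sum.inr = 0 := Sum.elim_comp_inr _ _
    rw [Sum.elim_inl, Sum.elim_comp_inl, hx, h0, Matrix.mulVec_zero, add_zero, Pi.zero_apply]
  rw [form_apply, form_apply] at h1
  simp only [h2, Sum.elim_inl, Sum.elim_inr] at h1
  have h3 : 0 ≤ ∑ j, (g.val *ᵥ Sum.elim x 0) (Sum.inr j) ^ 2 :=
    Finset.sum_nonneg fun _ _ => sq_nonneg _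
  have h4 : ∑ i, x i ^ 2 = 0 := by
    refine le_antisymm ?_ (Finset.sum_nonneg fun _ _ => sq_nonneg _)
    simp at h1
    linarith
  refine hx0 (funext fun i => ?_)
  exact pow_eq_zero_iff two_ne_zero |>.1
    ((Finset.sum_eq_zero_iff_of_nonneg fun _ _ => sq_nonneg _).1 h4 i (Finset.mem_univ i))

theorem det_toBlocks₁₁_pos {g : GL (Fin s ⊕ Fin t) ℝ} (hg : g ∈ SOPlus s t) :
    0 < g.val.toBlocks₁₁.det := by
  obtain ⟨h, hc⟩ := mem_SOPlus_iff.1 hg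
  by_contra hneg
  have hcont : Continuous fun x : SO s t => x.val.val.toBlocks₁₁.det := by
    have : Continuous fun x : SO s t => x.val.val.toBlocks₁₁ :=
      continuous_matrix fun i j =>
        (Units.continuous_val.comp continuous_subtype_val).matrix_elem (Sum.inl i) (Sum.inl j)
    exact this.matrix_det
  have h1 : ((1 : SO s t).val.val.toBlocks₁₁).det = 1 := by
    have e : (1 : SO s t).val.val.toBlocks₁₁ = 1 := by
      ext i j
      simp [Matrix.toBlocks₁₁, Matrix.one_apply]
    rw [e, Matrix.det_one]
  obtain ⟨y, -, hy⟩ := isPreconnected_connectedComponent.intermediate_value hc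
    mem_connectedComponent hcont.continuousOn (show (0 : ℝ) ∈ _ from
      ⟨not_lt.1 hneg, by rw [h1]; exact zero_le_one⟩)
  exact det_toBlocks₁₁_ne_zero y.2.1 hy

theorem reflectionMatrix_single (a : Fin s ⊕ Fin t) :
    reflectionMatrix (Pi.single a 1) = Matrix.diagonal fun i => if i = a then -1 else 1 := by
  refine Matrix.ext_of_mulVec_single fun i => ?_
  rw [reflectionMatrix_mulVec, Matrix.diagonal_mulVec_single]
  by_cases h : i = a
  · subst h
    rw [polar_form_self, mul_inv_cancel_right₀ (form_single_ne_zero i), if_pos rfl, two_smul]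
    ext j
    by_cases h : j = i <;> simp [h]
  · rw [polar_form_single_single (Ne.symm h), zero_mul, zero_smul, sub_zero, if_neg h, one_mul]

theorem det_toBlocks₁₁_reflection_mul_reflection (i : Fin s) (j : Fin t) :
    (reflection (Pi.single (Sum.inl i) 1) *
      reflection (Pi.single (Sum.inr j) 1)).val.toBlocks₁₁.det = -1 := by
  have h : (reflection (Pi.single (Sum.inl i) 1) *
      reflection (Pi.single (Sum.inr j) 1)).val.toBlocks₁₁ =
      Matrix.diagonal fun k : Fin s => if k = i then (-1 : ℝ) else 1 := by
    rw [Units.val_mul, show (reflection (Pi.single (Sum.inl i) 1)).val = _ from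
      reflectionMatrix_single _, show (reflection (Pi.single (Sum.inr j) 1)).val = _ from
      reflectionMatrix_single _, Matrix.diagonal_mul_diagonal]
    ext k l
    simp [Matrix.toBlocks₁₁, Matrix.diagonal_apply]
  rw [h, Matrix.det_diagonal, Finset.prod_ite_eq' Finset.univ i fun _ => (-1 : ℝ)]
  simp

theorem prod_form_pos_of_prod_reflection_mem_SOPlus {l : List (Fin s ⊕ Fin t → ℝ)}
    (hne : (l.map (form s t)).prod ≠ 0) (h : (l.map reflection).prod ∈ SOPlus s t) :
    0 < (l.map (form s t)).prod := by
  have hl : ∀ w ∈ l, form s t w ≠ 0 := fun w => form_ne_zero_of_prod_ne_zero hne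
  have hlen : Even l.length := (prod_reflection_mem_SO_iff hl).1 (mem_SOPlus_iff.1 h).1
  by_contra hneg
  have hneg : (l.map (form s t)).prod < 0 := lt_of_le_of_ne (not_lt.1 hneg) hne
  obtain ⟨⟨_, hb, hpos⟩, ⟨_, hc, hcneg⟩⟩ := exists_pos_and_exists_neg
    (by
      intro b hb
      obtain ⟨w, hw, rfl⟩ := List.mem_map.1 hb
      exact hl w hw) (by rwa [List.length_map]) hneg
  obtain ⟨v, -, rfl⟩ := List.mem_map.1 hb
  obtain ⟨w, -, rfl⟩ := List.mem_map.1 hc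
  have hs : Nonempty (Fin s) := by
    by_contra hs
    rw [not_nonempty_iff] at hs
    rw [form_apply, Fintype.sum_empty, zero_sub, neg_pos] at hpos
    exact absurd hpos (Finset.sum_nonneg fun _ _ => sq_nonneg _).not_gt
  have ht : Nonempty (Fin t) := by
    by_contra ht
    rw [not_nonempty_iff] at ht
    rw [form_apply, Fintype.sum_empty fun j => w (Sum.inr j) ^ 2, sub_zero] at hcneg
    exact absurd hcneg (Finset.sum_nonneg fun _ _ => sq_nonneg _).not_gt
  obtain ⟨i⟩ := hs
  obtain ⟨j⟩ := ht
  have hmem := prod_reflection_mem_SOPlus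
    (l := l ++ [Pi.single (Sum.inl i) 1, Pi.single (Sum.inr j) 1])
    (by simpa [Nat.even_add] using hlen)
    (by simpa [form_single] using hneg)
  rw [List.map_append, List.prod_append, Subgroup.mul_mem_cancel_left _ h] at hmem
  have hdet := det_toBlocks₁₁_pos hmem
  rw [List.map_cons, List.map_cons, List.map_nil, List.prod_cons, List.prod_cons, List.prod_nil,
    mul_one, det_toBlocks₁₁_reflection_mul_reflection] at hdet
  linarith

end IdentityComponent

end GeomAlg

namespace GeomAlg

open CliffordAlgebra QuadraticMap
open scoped Matrix

/-! ### The twisted adjoint representation of `Pin(s,t)` -/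

section Representation

variable {s t : ℕ}

/-- A relation between a subgroup of `Pin(s,t)` and a group of matrices that is given by the twisted
adjoint action and is total on both sides is a surjective homomorphism with kernel `{1, -1}`. -/
theorem exists_twistedAdjoint_hom (P : Subgroup (CliffordAlgebra (form s t))ˣ)
    (G : Subgroup (GL (Fin s ⊕ Fin t) ℝ)) (hP : P ≤ Pin (form s t)) (hneg : -1 ∈ P)
    (hmap : ∀ x ∈ P, ∃ g ∈ G, ∀ v, ι (form s t) (g.val *ᵥ v) =
      twistedAdjoint (form s t) x (ι (form s t) v))
    (hsurj : ∀ g ∈ G, ∃ x ∈ P, ∀ v, ι (form s t) (g.val *ᵥ v) =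
      twistedAdjoint (form s t) x (ι (form s t) v)) :
    ∃ φ : P →* G,
      (∀ x v, ι (form s t) ((φ x).val.val *ᵥ v) =
        twistedAdjoint (form s t) x.val (ι (form s t) v)) ∧
      Function.Surjective φ ∧
      Subtype.val '' (φ.ker : Set P) = {1, -1} := by
  have hinj := ι_injective (form s t)
  choose f hfG hf using fun x : P => hmap x x.2
  have huniq (x : P) (g : GL (Fin s ⊕ Fin t) ℝ) (hg : ∀ v, ι (form s t) (g.val *ᵥ v) =
      twistedAdjoint (form s t) x.val (ι (form s t) v)) : f x = g :=
    eq_of_mulVec_eq fun v => hinj (by rw [hf, hg])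
  let φ : P →* G := MonoidHom.mk' (fun x => ⟨f x, hfG x⟩) fun x y =>
    Subtype.ext <| huniq _ _ fun v => by
      rw [show (x * y).val = x.val * y.val from rfl, map_mul, Module.End.mul_apply, ← hf y, ← hf x,
        Matrix.mulVec_mulVec]
      rfl
  refine ⟨φ, hf, ?_, ?_⟩
  · rintro ⟨g, hg⟩
    obtain ⟨x, hx, hxg⟩ := hsurj g hg
    exact ⟨⟨x, hx⟩, Subtype.ext (huniq _ _ hxg)⟩
  · ext x
    constructor
    · rintro ⟨x, hx, rfl⟩
      refine eq_one_or_eq_neg_one_of_mem_Pin (form s t) (Pi.basisFun ℝ _)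
        polarBilin_form_surjective (hP x.2) fun v => ?_
      have h1 : f x = 1 := congrArg Subtype.val (show φ x = 1 from hx)
      rw [← hf, h1, Units.val_one, Matrix.one_mulVec]
    · rintro (rfl | rfl)
      · exact ⟨1, one_mem _, rfl⟩
      · refine ⟨⟨-1, hneg⟩, Subtype.ext (huniq _ 1 fun v => ?_), rfl⟩
        rw [twistedAdjoint_neg_one, Units.val_one, Matrix.one_mulVec]

theorem ι_prod_reflection_mulVec {l : List (Fin s ⊕ Fin t → ℝ)} (hl : ∀ v ∈ l, form s t v ≠ 0)
    {x : (CliffordAlgebra (form s t))ˣ} (hx : x.val = (l.map (ι (form s t))).prod)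
    (v : Fin s ⊕ Fin t → ℝ) : ι (form s t) ((l.map reflection).prod.val *ᵥ v) =
      twistedAdjoint (form s t) x (ι (form s t) v) := by
  rw [twistedAdjoint_ι_eq_iff, hx, involute_prod_mul_ι hl]

/-- Every element of `O(s,t)` is induced by a product of unit vectors in `Pin(s,t)`. -/
theorem exists_mem_Pin_eq_prod {g : GL (Fin s ⊕ Fin t) ℝ} (hg : g ∈ O s t) :
    ∃ l : List (Fin s ⊕ Fin t → ℝ), (∀ v ∈ l, form s t v ≠ 0) ∧ (l.map reflection).prod = g ∧
      ∃ x ∈ Pin (form s t), x.val = (l.map (ι (form s t))).prod := by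
  obtain ⟨l, hl, hlg⟩ := exists_list_prod_reflection hg
  have hl0 : ∀ v ∈ l, form s t v ≠ 0 := fun v hv => by
    rcases hl v hv with h | h <;> rw [h] <;> norm_num
  obtain ⟨x, hx⟩ := isUnit_prod_map_ι (form s t) hl0
  refine ⟨l, hl0, hlg, x, ⟨⟨l, hl0, hx⟩, ?_⟩, hx⟩
  rw [hx, prod_map_ι_mul_reverse]
  have h : (l.map (form s t)).prod = 1 ∨ (l.map (form s t)).prod = -1 :=
    prod_eq_one_or_neg_one (by
      intro b hb
      obtain ⟨v, hv, rfl⟩ := List.mem_map.1 hb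
      exact hl v hv)
  exact h.imp (fun h => by rw [h, map_one]) fun h => by rw [h, map_neg, map_one]

theorem even_length_of_mem_even {l : List (Fin s ⊕ Fin t → ℝ)}
    {x : (CliffordAlgebra (form s t))ˣ} (hx : x.val = (l.map (ι (form s t))).prod)
    (h : x.val ∈ even (form s t)) : Even l.length := by
  have : Invertible (2 : ℝ) := invertibleOfNonzero two_ne_zero
  exact even_length_of_prod_map_ι_mem_even (form s t) (hx ▸ x.ne_zero) (hx ▸ h)

end Representation

end GeomAlg

open GeomAlg CliffordAlgebra Matrix in
theorem mainTheorem5 (s t : ℕ) (hst : 0 < s + t) :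
    (∃ φ : Pin (form s t) →* O s t,
      (∀ x v, ι (form s t) ((φ x).val.val *ᵥ v) =
        twistedAdjoint (form s t) x.val (ι (form s t) v)) ∧
      Function.Surjective φ ∧
      Subtype.val '' (φ.ker : Set (Pin (form s t))) = {1, -1}) ∧
    (∃ φ : Spin (form s t) →* SO s t,
      (∀ x v, ι (form s t) ((φ x).val.val *ᵥ v) =
        twistedAdjoint (form s t) x.val (ι (form s t) v)) ∧
      Function.Surjective φ ∧
      Subtype.val '' (φ.ker : Set (Spin (form s t))) = {1, -1}) ∧
    (∃ φ : SpinPlus (form s t) →* SOPlus s t,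
      (∀ x v, ι (form s t) ((φ x).val.val *ᵥ v) =
        twistedAdjoint (form s t) x.val (ι (form s t) v)) ∧
      Function.Surjective φ ∧
      Subtype.val '' (φ.ker : Set (SpinPlus (form s t))) = {1, -1}) := by
  have : Invertible (2 : ℝ) := invertibleOfNonzero two_ne_zero
  have hinj := FaithfulSMul.algebraMap_injective ℝ (CliffordAlgebra (form s t))
  have hne : Nonempty (Fin s ⊕ Fin t) := by
    rw [← Fintype.card_pos_iff]
    simpa using hst
  obtain ⟨i⟩ := hne
  have hneg : -1 ∈ SpinPlus (form s t) := neg_one_mem_SpinPlus _ (form_single_ne_zero i)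
  refine ⟨exists_twistedAdjoint_hom _ _ le_rfl hneg.1.1 ?_ ?_,
    exists_twistedAdjoint_hom _ _ (fun _ h => h.1) hneg.1 ?_ ?_,
    exists_twistedAdjoint_hom _ _ (fun _ h => h.1.1) hneg ?_ ?_⟩
  · rintro x ⟨⟨l, hl, hx⟩, -⟩
    exact ⟨_, prod_reflection_mem_O l, ι_prod_reflection_mulVec hl hx⟩
  · intro g hg
    obtain ⟨l, hl, rfl, x, hxP, hx⟩ := exists_mem_Pin_eq_prod hg
    exact ⟨x, hxP, ι_prod_reflection_mulVec hl hx⟩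
  · rintro x ⟨⟨⟨l, hl, hx⟩, -⟩, heven⟩
    exact ⟨_, (prod_reflection_mem_SO_iff hl).2 (even_length_of_mem_even hx heven),
      ι_prod_reflection_mulVec hl hx⟩
  · intro g hg
    obtain ⟨l, hl, rfl, x, hxP, hx⟩ := exists_mem_Pin_eq_prod hg.1
    refine ⟨x, ⟨hxP, ?_⟩, ι_prod_reflection_mulVec hl hx⟩
    rw [hx]
    exact prod_map_ι_mem_even _ ((prod_reflection_mem_SO_iff hl).1 hg)
  · rintro x ⟨⟨⟨⟨l, hl, hx⟩, -⟩, heven⟩, hone⟩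
    refine ⟨_, prod_reflection_mem_SOPlus (even_length_of_mem_even hx heven) ?_,
      ι_prod_reflection_mulVec hl hx⟩
    rw [hx, prod_map_ι_mul_reverse, ← map_one (algebraMap ℝ _), hinj.eq_iff] at hone
    rw [hone]
    exact one_pos
  · intro g hg
    obtain ⟨hSO, -⟩ := mem_SOPlus_iff.1 hg
    obtain ⟨l, hl, rfl, x, hxP, hx⟩ := exists_mem_Pin_eq_prod hSO.1
    have heven : x.val ∈ even (form s t) := by
      rw [hx]
      exact prod_map_ι_mem_even _ ((prod_reflection_mem_SO_iff hl).1 hSO)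
    refine ⟨x, ⟨⟨hxP, heven⟩, hxP.2.resolve_right fun h => ?_⟩, ι_prod_reflection_mulVec hl hx⟩
    rw [hx, prod_map_ι_mul_reverse, ← map_one (algebraMap ℝ _), ← map_neg, hinj.eq_iff] at h
    have hpos := prod_form_pos_of_prod_reflection_mem_SOPlus (l := l) (by rw [h]; norm_num) hg
    rw [h] at hpos
    linarith
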